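/- All rings are associative, not necessarily with unity. Let $R$ be a prime ring, that is, $R\neq 0$ and $aRb=0$ implies $a=0$ or $b=0$ for $a,b\in R$. Let $Z(R)$ be its center, $Q_s(R)$ its Martindale symmetric ring of quotients, and let $C$ be the extended centroid of $R$, i.e. the center of $Q_s(R)$, which is a field. For $a,b\in Q_s(R)$ put $[a,b]=ab-ba$, and for subsets $A,B$ of $Q_s(R)$ let $[A,B]$ (resp. $AB$) denote the additive subgroup generated by all $[a,b]$ (resp. $ab$) with $a\in A$, $b\in B$; write $[a,B]$ for $[\{a\},B]$. A Lie ideal of $R$ is an additive subgroup $L$ of $R$ with $[L,R]\subseteq L$. The prime ring $R$ is called exceptional if $\operatorname{char} R=2$ and $\dim_C RC=4$. Theorem. Let $R$ be an exceptional prime ring, and let $L$ be a Lie ideal of $R$. Then at least one of the following holds: (1) $L\subseteq Z(R)$; (2) $LC=[a,RC]=Ca+C$ for some $a\in L\setminus Z(R)$; (3) $[RC,RC]\subseteq LC$. -/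

import Mathlib

/-- An associative ring, not necessarily unital, is prime if it is nonzero and `a R b = 0` forces
`a = 0` or `b = 0`. -/
class IsPrimeRing (R : Type*) [NonUnitalRing R] : Prop where
  exists_ne_zero : ∃ a : R, a ≠ 0
  eq_zero_or_eq_zero : ∀ a b : R, (∀ r : R, a * r * b = 0) → a = 0 ∨ b = 0

/-- The additive subgroup `[A, B]` generated by all commutators `ab - ba`, `a ∈ A`, `b ∈ B`. -/
def commutatorSubgroup {S : Type*} [NonUnitalRing S] (A B : Set S) : AddSubgroup S :=
  AddSubgroup.closure {z | ∃ a ∈ A, ∃ b ∈ B, z = a * b - b * a}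

/-- An additive subgroup `L` of `S` is a Lie ideal if `[L, S] ⊆ L`. -/
def IsLieIdeal {S : Type*} [NonUnitalRing S] (L : AddSubgroup S) : Prop :=
  commutatorSubgroup (L : Set S) Set.univ ≤ L

namespace Martindale

section ideals

variable {R : Type*} [NonUnitalRing R]

/-- The product `I J` of two ideals. -/
def idealMul (I J : TwoSidedIdeal R) : TwoSidedIdeal R :=
  TwoSidedIdeal.span {z | ∃ x ∈ I, ∃ y ∈ J, z = x * y}

theorem mem_idealMul {I J : TwoSidedIdeal R} {z : R} :
    z ∈ idealMul I J ↔ z ∈ AddSubgroup.closure {z | ∃ x ∈ I, ∃ y ∈ J, z = x * y} := by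
  refine TwoSidedIdeal.mem_span_iff_mem_addSubgroup_closure_absorbing ?_ ?_
  · rintro r _ ⟨x, hx, y, hy, rfl⟩
    exact ⟨r * x, I.mul_mem_left _ _ hx, y, hy, (mul_assoc _ _ _).symm⟩
  · rintro _ r ⟨x, hx, y, hy, rfl⟩
    exact ⟨x, hx, y * r, J.mul_mem_right _ _ hy, mul_assoc _ _ _⟩

theorem idealMul_le_left (I J : TwoSidedIdeal R) : idealMul I J ≤ I := by
  refine TwoSidedIdeal.span_le.2 ?_
  rintro _ ⟨x, hx, y, -, rfl⟩
  exact I.mul_mem_right _ _ hx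

theorem idealMul_le_right (I J : TwoSidedIdeal R) : idealMul I J ≤ J := by
  refine TwoSidedIdeal.span_le.2 ?_
  rintro _ ⟨x, -, y, hy, rfl⟩
  exact J.mul_mem_left _ _ hy

theorem exists_mem_ne_zero {I : TwoSidedIdeal R} (hI : I ≠ ⊥) : ∃ x ∈ I, x ≠ 0 := by
  by_contra! h
  exact hI (TwoSidedIdeal.ext fun x =>
    ⟨fun hx => (TwoSidedIdeal.mem_bot R).2 (h x hx), fun hx => by
      rw [(TwoSidedIdeal.mem_bot R).1 hx]; exact I.zero_mem⟩)

theorem ne_bot_of_mem {I : TwoSidedIdeal R} {x : R} (hx : x ∈ I) (h0 : x ≠ 0) : I ≠ ⊥ := by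
  rintro rfl
  exact h0 ((TwoSidedIdeal.mem_bot R).1 hx)

variable [IsPrimeRing R]

theorem top_ne_bot : (⊤ : TwoSidedIdeal R) ≠ ⊥ := by
  obtain ⟨a, ha⟩ := IsPrimeRing.exists_ne_zero (R := R)
  exact ne_bot_of_mem (TwoSidedIdeal.mem_top R) ha

theorem idealMul_ne_bot {I J : TwoSidedIdeal R} (hI : I ≠ ⊥) (hJ : J ≠ ⊥) :
    idealMul I J ≠ ⊥ := by
  obtain ⟨a, ha, ha0⟩ := exists_mem_ne_zero hI
  obtain ⟨b, hb, hb0⟩ := exists_mem_ne_zero hJ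
  have : ∃ r : R, a * r * b ≠ 0 := by
    by_contra! h
    rcases IsPrimeRing.eq_zero_or_eq_zero a b h with h | h
    exacts [ha0 h, hb0 h]
  obtain ⟨r, hr⟩ := this
  exact ne_bot_of_mem (TwoSidedIdeal.subset_span ⟨a * r, I.mul_mem_right _ _ ha, b, hb, rfl⟩) hr

theorem inf_ne_bot {I J : TwoSidedIdeal R} (hI : I ≠ ⊥) (hJ : J ≠ ⊥) : I ⊓ J ≠ ⊥ := by
  obtain ⟨x, hx, h0⟩ := exists_mem_ne_zero (idealMul_ne_bot hI hJ)
  exact ne_bot_of_mem ((TwoSidedIdeal.mem_inf R).2 ⟨idealMul_le_left I J hx, idealMul_le_right I J hx⟩)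
    h0

end ideals

/-- A homomorphism of right `R`-modules `f : I → R` whose domain `I` is a nonzero ideal of `R`.
It is stored as a function on `R`, of which only the values on `I` matter: the values elsewhere
are forgotten in the quotient `RightQuotients` below. -/
structure PartialHom (R : Type*) [NonUnitalRing R] where
  dom : TwoSidedIdeal R
  dom_ne_bot : dom ≠ ⊥
  toFun : R → R
  map_add : ∀ x ∈ dom, ∀ y ∈ dom, toFun (x + y) = toFun x + toFun y
  map_mul_right : ∀ x ∈ dom, ∀ r : R, toFun (x * r) = toFun x * r

namespace PartialHom

variable {R : Type*} [NonUnitalRing R]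

theorem map_zero (f : PartialHom R) : f.toFun 0 = 0 := by
  have := f.map_add 0 f.dom.zero_mem 0 f.dom.zero_mem
  simpa using this

theorem map_neg (f : PartialHom R) {x : R} (hx : x ∈ f.dom) : f.toFun (-x) = -f.toFun x := by
  have := f.map_add x hx (-x) (f.dom.neg_mem hx)
  rw [add_neg_cancel, f.map_zero] at this
  exact (neg_eq_of_add_eq_zero_right this.symm).symm

/-- A right module homomorphism defined on `J` maps `J I` into `I`. -/
theorem map_mem (g : PartialHom R) (I : TwoSidedIdeal R) {z : R} (hz : z ∈ idealMul g.dom I) :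
    g.toFun z ∈ I := by
  have key : z ∈ g.dom ∧ g.toFun z ∈ I := by
    refine AddSubgroup.closure_induction (p := fun z _ => z ∈ g.dom ∧ g.toFun z ∈ I)
      ?_ ?_ ?_ ?_ (mem_idealMul.1 hz)
    · rintro _ ⟨x, hx, y, hy, rfl⟩
      refine ⟨g.dom.mul_mem_right _ _ hx, ?_⟩
      rw [g.map_mul_right x hx]
      exact I.mul_mem_left _ _ hy
    · exact ⟨g.dom.zero_mem, by rw [g.map_zero]; exact I.zero_mem⟩
    · rintro x y - - ⟨hx, hx'⟩ ⟨hy, hy'⟩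
      exact ⟨g.dom.add_mem hx hy, by rw [g.map_add x hx y hy]; exact I.add_mem hx' hy'⟩
    · rintro x - ⟨hx, hx'⟩
      exact ⟨g.dom.neg_mem hx, by rw [g.map_neg hx]; exact I.neg_mem hx'⟩
  exact key.2

/-- Two partial homomorphisms are identified when they agree on a nonzero ideal contained in both
domains. -/
def Rel (f g : PartialHom R) : Prop :=
  ∃ K : TwoSidedIdeal R, K ≠ ⊥ ∧ ∀ x ∈ K, x ∈ f.dom ∧ x ∈ g.dom ∧ f.toFun x = g.toFun x

/-- The pointwise negative. -/
def neg (f : PartialHom R) : PartialHom R where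
  dom := f.dom
  dom_ne_bot := f.dom_ne_bot
  toFun x := -f.toFun x
  map_add x hx y hy := by rw [f.map_add x hx y hy, neg_add]
  map_mul_right x hx r := by rw [f.map_mul_right x hx, neg_mul]

theorem neg_congr {f g : PartialHom R} (h : Rel f g) : Rel f.neg g.neg := by
  obtain ⟨K, hK, h⟩ := h
  exact ⟨K, hK, fun x hx => ⟨(h x hx).1, (h x hx).2.1, congrArg Neg.neg (h x hx).2.2⟩⟩

variable [IsPrimeRing R]

instance setoid (R : Type*) [NonUnitalRing R] [IsPrimeRing R] : Setoid (PartialHom R) where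
  r := Rel
  iseqv :=
    { refl := fun f => ⟨f.dom, f.dom_ne_bot, fun _ hx => ⟨hx, hx, rfl⟩⟩
      symm := fun ⟨K, hK, h⟩ => ⟨K, hK, fun x hx => ⟨(h x hx).2.1, (h x hx).1, (h x hx).2.2.symm⟩⟩
      trans := fun ⟨K, hK, h⟩ ⟨K', hK', h'⟩ => ⟨K ⊓ K', inf_ne_bot hK hK', fun x hx =>
        have hx := (TwoSidedIdeal.mem_inf R).1 hx
        ⟨(h x hx.1).1, (h' x hx.2).2.1, (h x hx.1).2.2.trans (h' x hx.2).2.2⟩⟩ }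

theorem equiv_of_eq {f g : PartialHom R}
    (h : ∀ x ∈ f.dom, x ∈ g.dom → f.toFun x = g.toFun x) : Rel f g :=
  ⟨f.dom ⊓ g.dom, inf_ne_bot f.dom_ne_bot g.dom_ne_bot, fun x hx =>
    have hx := (TwoSidedIdeal.mem_inf R).1 hx
    ⟨hx.1, hx.2, h x hx.1 hx.2⟩⟩

/-- The zero map on `R`. -/
def zero (R : Type*) [NonUnitalRing R] [IsPrimeRing R] : PartialHom R where
  dom := ⊤
  dom_ne_bot := top_ne_bot
  toFun _ := 0
  map_add _ _ _ _ := (add_zero 0).symm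
  map_mul_right _ _ r := (zero_mul r).symm

/-- The identity map of `R`. -/
def one (R : Type*) [NonUnitalRing R] [IsPrimeRing R] : PartialHom R where
  dom := ⊤
  dom_ne_bot := top_ne_bot
  toFun x := x
  map_add _ _ _ _ := rfl
  map_mul_right _ _ _ := rfl

/-- The pointwise sum, on the intersection of the domains. -/
def add (f g : PartialHom R) : PartialHom R where
  dom := f.dom ⊓ g.dom
  dom_ne_bot := inf_ne_bot f.dom_ne_bot g.dom_ne_bot
  toFun x := f.toFun x + g.toFun x
  map_add x hx y hy := by
    rw [TwoSidedIdeal.mem_inf] at hx hy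
    rw [f.map_add x hx.1 y hy.1, g.map_add x hx.2 y hy.2, add_add_add_comm]
  map_mul_right x hx r := by
    rw [TwoSidedIdeal.mem_inf] at hx
    rw [f.map_mul_right x hx.1, g.map_mul_right x hx.2, add_mul]

/-- The composite `f ∘ g`, on the nonzero ideal `dom g * dom f`, which `g` maps into `dom f`. -/
def comp (f g : PartialHom R) : PartialHom R where
  dom := idealMul g.dom f.dom
  dom_ne_bot := idealMul_ne_bot g.dom_ne_bot f.dom_ne_bot
  toFun x := f.toFun (g.toFun x)
  map_add x hx y hy := by
    rw [g.map_add x (idealMul_le_left _ _ hx) y (idealMul_le_left _ _ hy),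
      f.map_add _ (g.map_mem _ hx) _ (g.map_mem _ hy)]
  map_mul_right x hx r := by
    rw [g.map_mul_right x (idealMul_le_left _ _ hx), f.map_mul_right _ (g.map_mem _ hx)]

/-- Left multiplication by `r`. -/
def mulLeft (r : R) : PartialHom R where
  dom := ⊤
  dom_ne_bot := top_ne_bot
  toFun x := r * x
  map_add x _ y _ := mul_add r x y
  map_mul_right x _ s := (mul_assoc r x s).symm

theorem add_congr {f f' g g' : PartialHom R} (h : Rel f f') (k : Rel g g') :
    Rel (f.add g) (f'.add g') := by
  obtain ⟨K, hK, h⟩ := h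
  obtain ⟨M, hM, k⟩ := k
  refine ⟨K ⊓ M, inf_ne_bot hK hM, fun x hx => ?_⟩
  rw [TwoSidedIdeal.mem_inf] at hx
  obtain ⟨h1, h2, h3⟩ := h x hx.1
  obtain ⟨k1, k2, k3⟩ := k x hx.2
  exact ⟨(TwoSidedIdeal.mem_inf R).2 ⟨h1, k1⟩, (TwoSidedIdeal.mem_inf R).2 ⟨h2, k2⟩,
    congrArg₂ (· + ·) h3 k3⟩

theorem comp_congr {f f' g g' : PartialHom R} (h : Rel f f') (k : Rel g g') :
    Rel (f.comp g) (f'.comp g') := by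
  obtain ⟨K, hK, h⟩ := h
  obtain ⟨M, hM, k⟩ := k
  refine ⟨(f.comp g).dom ⊓ (f'.comp g').dom ⊓ (M ⊓ idealMul g.dom K),
    inf_ne_bot (inf_ne_bot (f.comp g).dom_ne_bot (f'.comp g').dom_ne_bot)
      (inf_ne_bot hM (idealMul_ne_bot g.dom_ne_bot hK)), fun x hx => ?_⟩
  simp only [TwoSidedIdeal.mem_inf] at hx
  obtain ⟨⟨h1, h2⟩, h3, h4⟩ := hx
  refine ⟨h1, h2, ?_⟩
  change f.toFun (g.toFun x) = f'.toFun (g'.toFun x)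
  rw [← (k x h3).2.2]
  exact (h _ (g.map_mem K h4)).2.2

end PartialHom

/-- The right Martindale ring of quotients `Q_r(R)` of a prime ring `R`: right module homomorphisms
from nonzero ideals to `R`, modulo agreement on a nonzero ideal. -/
def RightQuotients (R : Type*) [NonUnitalRing R] [IsPrimeRing R] : Type _ :=
  Quotient (PartialHom.setoid R)

section ring

variable {R : Type*} [NonUnitalRing R] [IsPrimeRing R]

instance : Zero (RightQuotients R) := ⟨Quotient.mk _ (PartialHom.zero R)⟩

instance : One (RightQuotients R) := ⟨Quotient.mk _ (PartialHom.one R)⟩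

instance : Neg (RightQuotients R) := ⟨Quotient.map PartialHom.neg fun _ _ => PartialHom.neg_congr⟩

instance : Add (RightQuotients R) :=
  ⟨Quotient.map₂ PartialHom.add fun _ _ h _ _ k => PartialHom.add_congr h k⟩

instance : Mul (RightQuotients R) :=
  ⟨Quotient.map₂ PartialHom.comp fun _ _ h _ _ k => PartialHom.comp_congr h k⟩

/-- Addition is pointwise and multiplication is composition. -/
instance : Ring (RightQuotients R) where
  add_assoc a b c := by
    induction a, b, c using Quotient.inductionOn₃ with | _ f g h
    exact Quotient.sound (PartialHom.equiv_of_eq fun x _ _ => add_assoc _ _ _)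
  zero_add a := by
    induction a using Quotient.inductionOn with | _ f
    exact Quotient.sound (PartialHom.equiv_of_eq fun x _ _ => zero_add _)
  add_zero a := by
    induction a using Quotient.inductionOn with | _ f
    exact Quotient.sound (PartialHom.equiv_of_eq fun x _ _ => add_zero _)
  add_comm a b := by
    induction a, b using Quotient.inductionOn₂ with | _ f g
    exact Quotient.sound (PartialHom.equiv_of_eq fun x _ _ => add_comm _ _)
  neg_add_cancel a := by
    induction a using Quotient.inductionOn with | _ f
    exact Quotient.sound (PartialHom.equiv_of_eq fun x _ _ => neg_add_cancel _)
  mul_assoc a b c := by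
    induction a, b, c using Quotient.inductionOn₃ with | _ f g h
    exact Quotient.sound (PartialHom.equiv_of_eq fun x _ _ => rfl)
  one_mul a := by
    induction a using Quotient.inductionOn with | _ f
    exact Quotient.sound (PartialHom.equiv_of_eq fun x _ _ => rfl)
  mul_one a := by
    induction a using Quotient.inductionOn with | _ f
    exact Quotient.sound (PartialHom.equiv_of_eq fun x _ _ => rfl)
  zero_mul a := by
    induction a using Quotient.inductionOn with | _ f
    exact Quotient.sound (PartialHom.equiv_of_eq fun x _ _ => rfl)
  mul_zero a := by
    induction a using Quotient.inductionOn with | _ f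
    exact Quotient.sound (PartialHom.equiv_of_eq fun x _ _ => f.map_zero)
  left_distrib a b c := by
    induction a, b, c using Quotient.inductionOn₃ with | _ f g h
    refine Quotient.sound (PartialHom.equiv_of_eq fun x _ hx => ?_)
    obtain ⟨h1, h2⟩ := (TwoSidedIdeal.mem_inf R).1 hx
    exact f.map_add _ (g.map_mem _ h1) _ (h.map_mem _ h2)
  right_distrib a b c := by
    induction a, b, c using Quotient.inductionOn₃ with | _ f g h
    exact Quotient.sound (PartialHom.equiv_of_eq fun x _ _ => rfl)
  nsmul := nsmulRec
  zsmul := zsmulRec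

variable (R) in
/-- The embedding `R → Q_r(R)`, which sends `r` to left multiplication by `r`. -/
def toRightQuotients : R →ₙ+* RightQuotients R where
  toFun r := Quotient.mk _ (PartialHom.mulLeft r)
  map_zero' := Quotient.sound (PartialHom.equiv_of_eq fun x _ _ => zero_mul x)
  map_add' r s := Quotient.sound (PartialHom.equiv_of_eq fun x _ _ => add_mul r s x)
  map_mul' r s := Quotient.sound (PartialHom.equiv_of_eq fun x _ _ => mul_assoc r s x)

variable (R) in
/-- The Martindale symmetric ring of quotients `Q_s(R)` of a prime ring `R`: all `q ∈ Q_r(R)` such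
that `q I ⊆ R` and `I q ⊆ R` for some nonzero ideal `I` of `R`. -/
def symmetricQuotients : Subring (RightQuotients R) where
  carrier := {q | ∃ I : TwoSidedIdeal R, I ≠ ⊥ ∧ ∀ x ∈ I,
    (∃ y, q * toRightQuotients R x = toRightQuotients R y) ∧
    (∃ y, toRightQuotients R x * q = toRightQuotients R y)}
  zero_mem' := ⟨⊤, top_ne_bot, fun x _ => ⟨⟨0, by simp⟩, ⟨0, by simp⟩⟩⟩
  one_mem' := ⟨⊤, top_ne_bot, fun x _ => ⟨⟨x, by simp⟩, ⟨x, by simp⟩⟩⟩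
  neg_mem' := by
    rintro p ⟨I, hI, hp⟩
    refine ⟨I, hI, fun x hx => ?_⟩
    obtain ⟨⟨y, hy⟩, ⟨z, hz⟩⟩ := hp x hx
    exact ⟨⟨-y, by rw [neg_mul, hy, _root_.map_neg]⟩, ⟨-z, by rw [mul_neg, hz, _root_.map_neg]⟩⟩
  add_mem' := by
    rintro p q ⟨I, hI, hp⟩ ⟨J, hJ, hq⟩
    refine ⟨I ⊓ J, inf_ne_bot hI hJ, fun x hx => ?_⟩
    rw [TwoSidedIdeal.mem_inf] at hx
    obtain ⟨⟨y, hy⟩, ⟨z, hz⟩⟩ := hp x hx.1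
    obtain ⟨⟨y', hy'⟩, ⟨z', hz'⟩⟩ := hq x hx.2
    exact ⟨⟨y + y', by rw [add_mul, hy, hy', _root_.map_add]⟩,
      ⟨z + z', by rw [mul_add, hz, hz', _root_.map_add]⟩⟩
  mul_mem' := by
    rintro p q ⟨I, hI, hp⟩ ⟨J, hJ, hq⟩
    refine ⟨idealMul J I, idealMul_ne_bot hJ hI, fun x hx => ?_⟩
    refine AddSubgroup.closure_induction (p := fun x _ =>
      (∃ y, p * q * toRightQuotients R x = toRightQuotients R y) ∧
      (∃ y, toRightQuotients R x * (p * q) = toRightQuotients R y)) ?_ ?_ ?_ ?_ (mem_idealMul.1 hx)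
    · rintro _ ⟨u, hu, v, hv, rfl⟩
      constructor
      · obtain ⟨y, hy⟩ := (hq u hu).1
        obtain ⟨z, hz⟩ := (hp (y * v) (I.mul_mem_left _ _ hv)).1
        exact ⟨z, by rw [← hz, map_mul, map_mul, ← hy]; simp only [mul_assoc]⟩
      · obtain ⟨y, hy⟩ := (hp v hv).2
        obtain ⟨z, hz⟩ := (hq (u * y) (J.mul_mem_right _ _ hu)).2
        exact ⟨z, by rw [← hz, map_mul, map_mul, ← hy]; simp only [mul_assoc]⟩
    · exact ⟨⟨0, by simp⟩, ⟨0, by simp⟩⟩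
    · rintro a b - - ⟨⟨y, hy⟩, ⟨z, hz⟩⟩ ⟨⟨y', hy'⟩, ⟨z', hz'⟩⟩
      exact ⟨⟨y + y', by rw [_root_.map_add, mul_add, hy, hy', _root_.map_add]⟩,
        ⟨z + z', by rw [_root_.map_add, add_mul, hz, hz', _root_.map_add]⟩⟩
    · rintro a - ⟨⟨y, hy⟩, ⟨z, hz⟩⟩
      exact ⟨⟨-y, by rw [_root_.map_neg, mul_neg, hy, _root_.map_neg]⟩,
        ⟨-z, by rw [_root_.map_neg, neg_mul, hz, _root_.map_neg]⟩⟩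

end ring

variable (R : Type*) [NonUnitalRing R] [IsPrimeRing R]

/-- The Martindale symmetric ring of quotients `Q_s(R)`, as a type. -/
abbrev Qs : Type _ := symmetricQuotients R

/-- The embedding of `R` into `Q_s(R)`. -/
def toQs : R →ₙ+* Qs R where
  toFun r := ⟨toRightQuotients R r, ⊤, top_ne_bot, fun x _ =>
    ⟨⟨r * x, (map_mul _ _ _).symm⟩, ⟨x * r, (map_mul _ _ _).symm⟩⟩⟩
  map_zero' := Subtype.ext (_root_.map_zero _)
  map_add' r s := Subtype.ext (_root_.map_add _ r s)
  map_mul' r s := Subtype.ext (map_mul _ r s)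

/-- The embedding of `R` into `Q_s(R)` is injective, so that `R` is a subring of `Q_s(R)`. -/
theorem toQs_injective : Function.Injective (toQs R) := by
  rw [injective_iff_map_eq_zero]
  intro r hr
  have h : Quotient.mk (PartialHom.setoid R) (PartialHom.mulLeft r)
      = Quotient.mk _ (PartialHom.zero R) := congrArg Subtype.val hr
  obtain ⟨K, hK, h⟩ := Quotient.exact h
  obtain ⟨x, hx, hx0⟩ := exists_mem_ne_zero hK
  refine (IsPrimeRing.eq_zero_or_eq_zero r x fun s => ?_).resolve_right hx0
  rw [mul_assoc]
  exact (h (s * x) (K.mul_mem_left _ _ hx)).2.2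

/-- The extended centroid `C` of `R`: the center of `Q_s(R)`. -/
abbrev extendedCentroid : Subring (Qs R) := Subring.center (Qs R)

variable {R}

/-- `A C` for a subset `A` of `R`: the `C`-subspace of `Q_s(R)` generated by `A`. -/
def extendScalars (A : Set R) : Submodule (extendedCentroid R) (Qs R) :=
  Submodule.span (extendedCentroid R) (toQs R '' A)

/-- `A C` is the additive subgroup generated by the products `a c`, `a ∈ A`, `c ∈ C`. -/
theorem extendScalars_toAddSubgroup (A : Set R) :
    (extendScalars A).toAddSubgroup =
      AddSubgroup.closure {z | ∃ a ∈ A, ∃ c ∈ extendedCentroid R, z = toQs R a * c} := by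
  apply le_antisymm
  · intro z hz
    refine Submodule.closure_induction (p := fun z _ => z ∈ AddSubgroup.closure
      {z | ∃ a ∈ A, ∃ c ∈ extendedCentroid R, z = toQs R a * c}) ?_ ?_ ?_ hz
    · exact zero_mem _
    · exact fun x y _ _ hx hy => add_mem hx hy
    · rintro c _ ⟨a, ha, rfl⟩
      exact AddSubgroup.subset_closure ⟨a, ha, c, c.2, (Subring.mem_center_iff.1 c.2 _).symm⟩
  · refine (AddSubgroup.closure_le _).2 ?_
    rintro _ ⟨a, ha, c, hc, rfl⟩
    rw [Subring.mem_center_iff.1 hc]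
    exact Submodule.smul_mem _ (⟨c, hc⟩ : extendedCentroid R)
      (Submodule.subset_span ⟨a, ha, rfl⟩)

variable (R)

/-- The central closure `R C` of `R`. -/
abbrev centralClosure : Submodule (extendedCentroid R) (Qs R) := extendScalars (Set.univ : Set R)

/-- A prime ring `R` is exceptional if `char R = 2` and `dim_C RC = 4`. The characteristic of the
possibly nonunital ring `R` is the exponent of its additive group (`0` if there is none). -/
def IsExceptional : Prop :=
  AddMonoid.exponent R = 2 ∧ Module.rank (extendedCentroid R) (centralClosure R) = 4

end Martindale

/-! The theorem reduces to a computation with inner derivations in a four-dimensional algebra over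
the field `C`; no splitting field or matrix units are needed.

Reduction. Every nonzero ideal `I` of `R` satisfies `1 ∈ IC` (`one_mem_of_prime`): `RC + C` is a
prime Artinian ring, hence semisimple, so `IC` has a right identity, which primeness forces to be
`1`. Any `q ∈ Q_s(R)` has `qI ⊆ R` for some such `I`, whence `q = q1 ∈ RC`. Thus `Q_s(R) = RC =: Q`
is a prime unital algebra of dimension 4 and characteristic two, and `LC` is a Lie ideal of `Q`.

Classification (`lieIdeal_trichotomy`). For noncentral `a`, the map `[a, ·]` has rank at least two,
so the centralizer of `a` is exactly `Ca + C`; in particular `a² = sa + n` with `s, n ∈ C`. If some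
noncentral `a ∈ L` has `s ≠ 0`, then `LC = Q`. Otherwise `[a, Q] = Ca + C` for every noncentral `a ∈
L`. Fix one such `a`. Either `L ⊆ Ca + C`, which gives (2), or some `b ∈ L` lies outside; then `LC`
has codimension at most one, with `ab` spanning a complement modulo `LC`, and this gives (3). -/

namespace Martindale

/-! ### Primeness of `Q_s(R)` and the extended centroid as a field -/

section quotients

variable {R : Type*} [NonUnitalRing R] [IsPrimeRing R]

theorem toRightQuotients_injective : Function.Injective (toRightQuotients R) := fun _ _ h =>
  toQs_injective R (Subtype.ext h)

/-- The class of a partial homomorphism in `Q_r(R)`. -/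
def RightQuotients.mk (f : PartialHom R) : RightQuotients R := Quotient.mk _ f

/-- Right linearity `f(xy) = f(x)y` says that `f` composed with left multiplication by `x` is left
multiplication by `f(x)`. -/
theorem mk_mul_toRightQuotients (f : PartialHom R) {x : R} (hx : x ∈ f.dom) :
    RightQuotients.mk f * toRightQuotients R x =
      toRightQuotients R (f.toFun x) :=
  Quotient.sound (s := PartialHom.setoid R)
    (PartialHom.equiv_of_eq fun y _ _ => f.map_mul_right x hx y)

/-- An element of `Q_r(R)` that annihilates a nonzero ideal on its right vanishes. -/
theorem RightQuotients.eq_zero_of_mul_ideal {q : RightQuotients R} {I : TwoSidedIdeal R}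
    (hI : I ≠ ⊥) (h : ∀ x ∈ I, q * toRightQuotients R x = 0) : q = 0 := by
  induction q using Quotient.inductionOn with | _ f
  refine Quotient.sound ⟨I ⊓ f.dom, inf_ne_bot hI f.dom_ne_bot, fun x hx => ?_⟩
  obtain ⟨h1, h2⟩ := (TwoSidedIdeal.mem_inf R).1 hx
  refine ⟨h2, TwoSidedIdeal.mem_top R, toRightQuotients_injective ?_⟩
  refine (mk_mul_toRightQuotients f h2).symm.trans ((h x h1).trans ?_)
  exact (_root_.map_zero _).symm

theorem Qs.exists_ideal (q : Qs R) : ∃ I : TwoSidedIdeal R, I ≠ ⊥ ∧ ∀ x ∈ I,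
    (∃ y, q * toQs R x = toQs R y) ∧ (∃ y, toQs R x * q = toQs R y) := by
  obtain ⟨I, hI, h⟩ := q.2
  refine ⟨I, hI, fun x hx => ?_⟩
  obtain ⟨⟨y, hy⟩, ⟨z, hz⟩⟩ := h x hx
  exact ⟨⟨y, Subtype.ext hy⟩, ⟨z, Subtype.ext hz⟩⟩

theorem Qs.eq_zero_of_mul_ideal {q : Qs R} {I : TwoSidedIdeal R} (hI : I ≠ ⊥)
    (h : ∀ x ∈ I, q * toQs R x = 0) : q = 0 :=
  Subtype.ext (RightQuotients.eq_zero_of_mul_ideal hI fun x hx => congrArg Subtype.val (h x hx))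

/-- On this side vanishing is not built into the construction. Choosing `K` with `qK ⊆ R`, each `y =
qx` with `x ∈ K` satisfies `iRy ⊆ Iqx = 0`, and primeness of `R` gives `y = 0`. -/
theorem Qs.eq_zero_of_ideal_mul {q : Qs R} {I : TwoSidedIdeal R} (hI : I ≠ ⊥)
    (h : ∀ x ∈ I, toQs R x * q = 0) : q = 0 := by
  obtain ⟨K, hK, hq⟩ := q.exists_ideal
  refine Qs.eq_zero_of_mul_ideal hK fun x hx => ?_
  obtain ⟨y, hy⟩ := (hq x hx).1
  obtain ⟨i, hi, hi0⟩ := exists_mem_ne_zero hI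
  have hy0 : y = 0 := by
    refine (IsPrimeRing.eq_zero_or_eq_zero i y fun r => toQs_injective R ?_).resolve_left hi0
    rw [map_mul, ← hy, ← mul_assoc, h _ (I.mul_mem_right _ _ hi), zero_mul, _root_.map_zero]
  rw [hy, hy0, _root_.map_zero]

/-- `Q_s(R)` is prime, even relative to its subring `R`. -/
theorem Qs.eq_zero_or_eq_zero {p q : Qs R} (h : ∀ r, p * toQs R r * q = 0) : p = 0 ∨ q = 0 := by
  by_contra! hpq
  obtain ⟨I, hI, hp⟩ := p.exists_ideal
  obtain ⟨J, hJ, hq⟩ := q.exists_ideal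
  have : ∃ x ∈ I, p * toQs R x ≠ 0 := by
    by_contra! h0
    exact hpq.1 (Qs.eq_zero_of_mul_ideal hI h0)
  obtain ⟨x, hx, hx0⟩ := this
  have : ∃ y ∈ J, toQs R y * q ≠ 0 := by
    by_contra! h0
    exact hpq.2 (Qs.eq_zero_of_ideal_mul hJ h0)
  obtain ⟨y, hy, hy0⟩ := this
  obtain ⟨u, hu⟩ := (hp x hx).1
  obtain ⟨v, hv⟩ := (hq y hy).2
  rcases IsPrimeRing.eq_zero_or_eq_zero u v fun r => toQs_injective R (by
    rw [map_mul, map_mul, ← hu, ← hv, _root_.map_zero]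
    have := h (x * r * y)
    rw [map_mul, map_mul] at this
    simpa only [mul_assoc] using this) with h0 | h0
  · exact hx0 (by rw [hu, h0, _root_.map_zero])
  · exact hy0 (by rw [hv, h0, _root_.map_zero])

/-- The centralizer of `R` in `Q_s(R)` is the extended centroid. -/
theorem mem_extendedCentroid_of_commute {q : Qs R} (h : ∀ r, q * toQs R r = toQs R r * q) :
    q ∈ extendedCentroid R := by
  rw [Subring.mem_center_iff]
  intro p
  obtain ⟨I, hI, hp⟩ := p.exists_ideal
  rw [← sub_eq_zero]
  -- For `x` in an ideal with `px ∈ R`: `pqx = (px)q = q(px)`.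
  refine Qs.eq_zero_of_mul_ideal hI fun x hx => ?_
  obtain ⟨y, hy⟩ := (hp x hx).1
  rw [sub_mul, mul_assoc p, h, ← mul_assoc, mul_assoc q, hy, h, sub_self]

theorem extendedCentroid_mul_eq_zero {c q : Qs R} (hc : c ∈ extendedCentroid R) (h0 : c ≠ 0)
    (h : c * q = 0) : q = 0 :=
  (Qs.eq_zero_or_eq_zero fun r => by
    rw [← Subring.mem_center_iff.1 hc, mul_assoc, h, mul_zero]).resolve_left h0

/-- Multiplication by `c` is injective and carries `I` onto a nonzero ideal `J = cI` of `R`. The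
inverse map `g : J → I` is right linear and represents the inverse `d`. It lies in `Q_s(R)` because
`y = g(y)c` gives `yd = g(y) ∈ R` for `y ∈ J`. -/
theorem exists_inv_extendedCentroid {c : Qs R} (hc : c ∈ extendedCentroid R) (h0 : c ≠ 0) :
    ∃ d ∈ extendedCentroid R, c * d = 1 := by
  obtain ⟨I, hI, hcI⟩ := c.exists_ideal
  have hcomm := Subring.mem_center_iff.1 hc
  have hinj : ∀ x y : R, c * toQs R x = c * toQs R y → x = y := fun x y h =>
    toQs_injective R (sub_eq_zero.1 (extendedCentroid_mul_eq_zero hc h0 (by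
      rw [mul_sub, h, sub_self])))
  let J : TwoSidedIdeal R := TwoSidedIdeal.mk' {y | ∃ x ∈ I, c * toQs R x = toQs R y}
    ⟨0, I.zero_mem, by simp⟩
    (by
      rintro y y' ⟨x, hx, h⟩ ⟨x', hx', h'⟩
      exact ⟨x + x', I.add_mem hx hx', by rw [_root_.map_add, mul_add, h, h', _root_.map_add]⟩)
    (by
      rintro y ⟨x, hx, h⟩
      exact ⟨-x, I.neg_mem hx, by rw [_root_.map_neg, mul_neg, h, _root_.map_neg]⟩)
    (by
      rintro r y ⟨x, hx, h⟩
      exact ⟨r * x, I.mul_mem_left _ _ hx, by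
        rw [map_mul, map_mul, ← h, ← mul_assoc, ← mul_assoc, hcomm]⟩)
    (by
      rintro y r ⟨x, hx, h⟩
      exact ⟨x * r, I.mul_mem_right _ _ hx, by rw [map_mul, map_mul, ← h, mul_assoc]⟩)
  have hJ : ∀ y, y ∈ J ↔ ∃ x ∈ I, c * toQs R x = toQs R y := fun y =>
    TwoSidedIdeal.mem_mk' ..
  have hJ0 : J ≠ ⊥ := by
    obtain ⟨x, hx, hx0⟩ := exists_mem_ne_zero hI
    obtain ⟨y, hy⟩ := (hcI x hx).1
    refine ne_bot_of_mem ((hJ y).2 ⟨x, hx, hy⟩) ?_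
    rintro rfl
    exact hx0 (hinj _ _ (by rw [hy, _root_.map_zero, mul_zero]))
  choose! g hgI hg using fun y => (hJ y).1
  let f : PartialHom R :=
    { dom := J
      dom_ne_bot := hJ0
      toFun := g
      map_add := fun x hx y hy => hinj _ _ (by
        rw [hg _ (J.add_mem hx hy), _root_.map_add, _root_.map_add, mul_add, hg x hx, hg y hy])
      map_mul_right := fun x hx r => hinj _ _ (by
        rw [hg _ (J.mul_mem_right _ _ hx), map_mul, map_mul, ← mul_assoc, hg x hx]) }
  have hf : ∀ y ∈ J, RightQuotients.mk f *
      toRightQuotients R y = toRightQuotients R (g y) := fun y hy => mk_mul_toRightQuotients f hy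
  have hcf : c.1 * RightQuotients.mk f = 1 := by
    rw [← sub_eq_zero]
    refine RightQuotients.eq_zero_of_mul_ideal hJ0 fun y hy => ?_
    rw [sub_mul, mul_assoc, hf y hy, one_mul, sub_eq_zero]
    exact congrArg Subtype.val (hg y hy)
  let d : Qs R := ⟨RightQuotients.mk f, J, hJ0, fun y hy => ⟨⟨g y, hf y hy⟩, g y, by
    rw [show toRightQuotients R y = toRightQuotients R (g y) * c.1 from
      congrArg Subtype.val ((hg y hy).symm.trans (hcomm _).symm), mul_assoc, hcf, mul_one]⟩⟩
  have hcd : c * d = 1 := Subtype.ext hcf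
  refine ⟨d, Subring.mem_center_iff.2 fun p => ?_, hcd⟩
  calc p * d = (d * c) * (p * d) := by rw [hcomm d, hcd, one_mul]
    _ = d * (p * c) * d := by rw [hcomm p]; simp only [mul_assoc]
    _ = d * p := by rw [mul_assoc, mul_assoc, hcd, mul_one]

instance : Nontrivial (Qs R) := by
  obtain ⟨a, ha⟩ := IsPrimeRing.exists_ne_zero (R := R)
  exact ⟨toQs R a, 0, fun h => ha (toQs_injective R (by rw [h, _root_.map_zero]))⟩

theorem isField_extendedCentroid : IsField (extendedCentroid R) where
  exists_pair_ne := exists_pair_ne _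
  mul_comm := mul_comm
  mul_inv_cancel := by
    rintro ⟨c, hc⟩ h0
    obtain ⟨d, hd, h⟩ := exists_inv_extendedCentroid hc fun h => h0 (Subtype.ext h)
    exact ⟨⟨d, hd⟩, Subtype.ext h⟩

end quotients

end Martindale

/-! ### Prime Artinian rings and the unity of finite-dimensional prime algebras -/

section semisimple

variable {S : Type*} [Ring S]

/-- The Jacobson radical `J` is nilpotent. If `J ≠ 0`, the last nonzero power `J^k` satisfies `J^k S
J ⊆ J^(k+1) = 0`, against primeness. -/
theorem isSemisimpleRing_of_isArtinianRing_of_prime [IsArtinianRing S] [Nontrivial S]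
    (hS : ∀ p q : S, (∀ x, p * x * q = 0) → p = 0 ∨ q = 0) : IsSemisimpleRing S := by
  rw [IsArtinianRing.isSemisimpleRing_iff_jacobson]
  have key : ∀ k : ℕ, Ring.jacobson S ^ k = ⊥ → Ring.jacobson S = ⊥ := by
    intro k
    induction k with
    | zero =>
      intro h
      rw [Submodule.pow_zero, Ideal.one_eq_top] at h
      exact absurd h top_ne_bot
    | succ k ih =>
      intro h
      by_contra hJ
      obtain ⟨x, hx, hx0⟩ := Submodule.exists_mem_ne_zero_of_ne_bot (mt ih hJ)
      obtain ⟨y, hy, hy0⟩ := Submodule.exists_mem_ne_zero_of_ne_bot hJ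
      refine (hS x y fun s => ?_).elim hx0 hy0
      rw [← Ideal.mem_bot, ← h, Submodule.pow_succ, mul_assoc]
      exact Ideal.mul_mem_mul hx (Ideal.mul_mem_left _ s hy)
  obtain ⟨n, hn⟩ := IsSemiprimaryRing.isNilpotent (R := S)
  exact key n hn

/-- With `K` a complementary left ideal and `1 = e + f`, the element `xf = x - xe` lies in `J ∩ K =
0` for `x ∈ J`. -/
theorem exists_right_identity_of_isSemisimpleRing [IsSemisimpleRing S] (J : Ideal S) :
    ∃ e ∈ J, ∀ x ∈ J, x * e = x := by
  obtain ⟨K, hK⟩ := exists_isCompl J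
  obtain ⟨e, he, f, hf, hef⟩ := Submodule.mem_sup.1
    (hK.sup_eq_top ▸ Submodule.mem_top (x := (1 : S)))
  refine ⟨e, he, fun x hx => ?_⟩
  have hxf : x * f = x - x * e := by rw [eq_sub_iff_add_eq', ← mul_add, hef, mul_one]
  have : x * f ∈ J ⊓ K :=
    ⟨hxf ▸ J.sub_mem hx (J.mul_mem_left _ he), K.mul_mem_left _ hf⟩
  rw [hK.inf_eq_bot, Submodule.mem_bot, hxf, sub_eq_zero] at this
  exact this.symm

end semisimple

/-- A nonzero ideal of a finite-dimensional subalgebra `A` without unity of `Q` contains the unity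
of `Q` if `Q` is prime relative to `A`. -/
theorem one_mem_of_prime {F Q : Type*} [Field F] [Ring Q] [Algebra F Q] (A J : Submodule F Q)
    [FiniteDimensional F A] (hA : ∀ x ∈ A, ∀ y ∈ A, x * y ∈ A)
    (hQ : ∀ p q : Q, (∀ x ∈ A, p * x * q = 0) → p = 0 ∨ q = 0) (hJA : J ≤ A)
    (hl : ∀ x ∈ A, ∀ y ∈ J, x * y ∈ J) (hr : ∀ x ∈ J, ∀ y ∈ A, x * y ∈ J) (hJ : J ≠ ⊥) :
    (1 : Q) ∈ J := by
  obtain ⟨j, hj, hj0⟩ := Submodule.exists_mem_ne_zero_of_ne_bot hJ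
  have hS : ∀ x, x ∈ A ⊔ F ∙ (1 : Q) ↔ ∃ y ∈ A, ∃ c : F, y + c • (1 : Q) = x := fun x => by
    simp only [Submodule.mem_sup, Submodule.mem_span_singleton, exists_exists_eq_and]
  -- Adjoining the unity of `Q` to `A` gives a unital ring to which semisimplicity applies.
  let S : Subalgebra F Q :=
    { (A ⊔ F ∙ (1 : Q)) with
      mul_mem' := by
        intro x y hx hy
        obtain ⟨x, hx', c, rfl⟩ := (hS _).1 hx
        obtain ⟨y, hy', d, rfl⟩ := (hS _).1 hy
        refine (hS _).2 ⟨x * y + d • x + c • y, A.add_mem (A.add_mem (hA x hx' y hy')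
          (A.smul_mem _ hx')) (A.smul_mem _ hy'), c * d, ?_⟩
        simp only [add_mul, mul_add, smul_mul_assoc, mul_smul_comm, one_mul, mul_one, smul_add,
          smul_smul, mul_comm d c]
        abel
      algebraMap_mem' := fun c => (hS _).2 ⟨0, A.zero_mem, c, by
        rw [zero_add, Algebra.algebraMap_eq_smul_one]⟩ }
  have hAS : ∀ x ∈ A, x ∈ S := fun x hx => (le_sup_left : A ≤ A ⊔ F ∙ (1 : Q)) hx
  have : FiniteDimensional F S :=
    inferInstanceAs (FiniteDimensional F ↥(A ⊔ F ∙ (1 : Q)))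
  have : IsArtinianRing S := IsArtinianRing.of_finite F S
  have : Nontrivial S := ⟨⟨⟨j, hAS j (hJA hj)⟩, 0, fun h => hj0 (congrArg Subtype.val h)⟩⟩
  have : IsSemisimpleRing S := isSemisimpleRing_of_isArtinianRing_of_prime fun p q h => by
    rcases hQ p.1 q.1 fun x hx => congrArg Subtype.val (h ⟨x, hAS x hx⟩) with h | h
    exacts [Or.inl (Subtype.ext h), Or.inr (Subtype.ext h)]
  let I : Ideal S :=
    { carrier := {x | x.1 ∈ J}
      add_mem' := fun hx hy => J.add_mem hx hy
      zero_mem' := J.zero_mem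
      smul_mem' := by
        rintro ⟨c, hc⟩ ⟨x, hx'⟩ hx
        obtain ⟨y, hy, d, rfl⟩ := (hS _).1 hc
        change (y + d • (1 : Q)) * x ∈ J
        rw [add_mul, smul_mul_assoc, one_mul]
        exact J.add_mem (hl y hy x hx) (J.smul_mem _ hx) }
  obtain ⟨e, he, h⟩ := exists_right_identity_of_isSemisimpleRing I
  have hJe : ∀ x ∈ J, x * e.1 = x := fun x hx => congrArg Subtype.val (h ⟨x, hAS x (hJA hx)⟩ hx)
  -- `jA ⊆ J` and `J(1 - e) = 0`, so `jA(1 - e) = 0`.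
  have h1 : 1 - e.1 = 0 := (hQ j (1 - e.1) fun x hx => by
    rw [mul_sub, mul_one, hJe _ (hr j hj x hx), sub_self]).resolve_left hj0
  rw [sub_eq_zero.1 h1]
  exact he

/-! ### Lie ideals of four-dimensional prime algebras of characteristic two -/

section quaternion

variable {F Q : Type*} [Field F] [Ring Q] [Algebra F Q]

/-- The inner derivation `x ↦ ax - xa`. -/
def innerDerivation (F : Type*) {Q : Type*} [Field F] [Ring Q] [Algebra F Q] (a : Q) : Q →ₗ[F] Q :=
  LinearMap.mulLeft F a - LinearMap.mulRight F a

@[simp]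
theorem innerDerivation_apply (a x : Q) : innerDerivation F a x = a * x - x * a := rfl

theorem mem_ker_innerDerivation {a x : Q} :
    x ∈ LinearMap.ker (innerDerivation F a) ↔ a * x = x * a := by
  rw [LinearMap.mem_ker, innerDerivation_apply, sub_eq_zero]

theorem mem_span_self_one {a x : Q} :
    x ∈ F ∙ a ⊔ F ∙ (1 : Q) ↔ ∃ p q : F, p • a + q • (1 : Q) = x := by
  simp only [Submodule.mem_sup, Submodule.mem_span_singleton, exists_exists_eq_and]

theorem commute_of_mem_span_self_one {a x : Q} (h : x ∈ F ∙ a ⊔ F ∙ (1 : Q)) : a * x = x * a := by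
  obtain ⟨p, q, rfl⟩ := mem_span_self_one.1 h
  simp only [mul_add, add_mul, mul_smul_comm, smul_mul_assoc, mul_one, one_mul]

theorem finrank_span_self_one {a x : Q} (ha : a * x ≠ x * a) :
    Module.finrank F ↥(F ∙ a ⊔ F ∙ (1 : Q)) = 2 := by
  have hli : LinearIndependent F ![a, 1] := by
    rw [LinearIndependent.pair_iff]
    intro s t h
    have hs : s • (a * x - x * a) = 0 := by
      have := congrArg (fun u => u * x - x * u) h
      simpa [add_mul, mul_add, ← smul_sub] using this
    have hs0 : s = 0 := (smul_eq_zero.1 hs).resolve_right (sub_ne_zero.2 ha)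
    refine ⟨hs0, (smul_eq_zero.1 (by rwa [hs0, zero_smul, zero_add] at h)).resolve_right ?_⟩
    rintro h1
    exact ha (by rw [← one_mul (a * x), ← one_mul (x * a), h1, zero_mul, zero_mul])
  have := finrank_span_eq_card hli
  rwa [Matrix.range_cons, Matrix.range_cons, Matrix.range_empty, Set.union_empty,
    Submodule.span_union, Fintype.card_fin] at this

/-- In a prime algebra, the inner derivation of a noncentral element has rank at least two. -/
theorem two_le_finrank_range_innerDerivation [FiniteDimensional F Q]
    (hQ : ∀ p q : Q, (∀ x, p * x * q = 0) → p = 0 ∨ q = 0) {a : Q}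
    (ha : ∀ c : F, a ≠ c • (1 : Q)) {z : Q} (haz : a * z ≠ z * a) :
    2 ≤ Module.finrank F (LinearMap.range (innerDerivation F a)) := by
  by_contra hlt
  obtain ⟨⟨y, hy'⟩, hy⟩ := finrank_le_one_iff.1 (show Module.finrank F
    (LinearMap.range (innerDerivation F a)) ≤ 1 by omega)
  -- Rank at most one means `[a, x] = φ(x)y`. Put `λ = φ(z)⁻¹φ(az)`. Then `[a, az] = a[a, z]` gives
  -- `(a - λ)y = 0`, and the Leibniz rule for `[a, xz]` writes `φ(z)xy` as a combination of `y` and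
  -- `yz`. Hence `(a - λ)xy = 0` for all `x`.
  have hφ : ∀ x, ∃ c : F, a * x - x * a = c • y := fun x => by
    obtain ⟨c, hc⟩ := hy ⟨_, LinearMap.mem_range_self (innerDerivation F a) x⟩
    exact ⟨c, (congrArg Subtype.val hc).symm⟩
  choose φ hφ using hφ
  have hz : φ z ≠ 0 := fun h => haz (by rw [← sub_eq_zero, hφ, h, zero_smul])
  have hy0 : y ≠ 0 := fun h => haz (by rw [← sub_eq_zero, hφ, h, smul_zero])
  have hay : (a - ((φ z)⁻¹ * φ (a * z)) • 1) * y = 0 := by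
    have : φ z • (a * y) = φ (a * z) • y := by
      rw [← hφ, ← mul_smul_comm, ← hφ, mul_sub, mul_assoc]
    rw [sub_mul, smul_mul_assoc, one_mul, mul_smul, ← this, inv_smul_smul₀ hz, sub_self]
  have key : ∀ x, (a - ((φ z)⁻¹ * φ (a * z)) • 1) * x * y = 0 := by
    intro x
    have h1 : φ z • (x * y) = φ (x * z) • y - φ x • (y * z) := by
      rw [← hφ, ← mul_smul_comm, ← smul_mul_assoc, ← hφ, ← hφ]
      noncomm_ring
    rw [← (IsUnit.mk0 _ hz).smul_eq_zero, mul_assoc, ← mul_smul_comm, h1, mul_sub, mul_smul_comm,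
      mul_smul_comm, ← mul_assoc, hay, zero_mul, smul_zero, smul_zero, sub_zero]
  rcases hQ _ _ key with h | h
  · exact ha _ (sub_eq_zero.1 h)
  · exact hy0 h

theorem ne_smul_one_of_exists_not_commute {a : Q} (h : ∃ x, a * x ≠ x * a) (c : F) :
    a ≠ c • (1 : Q) := by
  rintro rfl
  obtain ⟨x, hx⟩ := h
  exact hx (by rw [smul_mul_assoc, mul_smul_comm, one_mul, mul_one])

variable [FiniteDimensional F Q]

/-- The centralizer of a noncentral element `a` of a four-dimensional prime algebra is
`F a + F`. -/
theorem ker_innerDerivation (hQ : ∀ p q : Q, (∀ x, p * x * q = 0) → p = 0 ∨ q = 0)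
    (h4 : Module.finrank F Q = 4) {a z : Q} (ha : a * z ≠ z * a) :
    LinearMap.ker (innerDerivation F a) = F ∙ a ⊔ F ∙ (1 : Q) := by
  refine (Submodule.eq_of_le_of_finrank_le
    (fun x hx => mem_ker_innerDerivation.2 (commute_of_mem_span_self_one hx)) ?_).symm
  have h1 := two_le_finrank_range_innerDerivation hQ (F := F)
    (ne_smul_one_of_exists_not_commute ⟨z, ha⟩) ha
  have h2 := LinearMap.finrank_range_add_finrank_ker (innerDerivation F a)
  rw [finrank_span_self_one ha]
  omega

/-- In characteristic two, `[a, Q] = F a + F` for a noncentral `a` with central square. -/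
theorem range_innerDerivation (hQ : ∀ p q : Q, (∀ x, p * x * q = 0) → p = 0 ∨ q = 0)
    (h4 : Module.finrank F Q = 4) (h2 : ∀ x : Q, x + x = 0) {a z : Q} (ha : a * z ≠ z * a)
    {n : F} (hn : a * a = n • (1 : Q)) :
    LinearMap.range (innerDerivation F a) = F ∙ a ⊔ F ∙ (1 : Q) := by
  rw [← ker_innerDerivation hQ h4 ha]
  refine Submodule.eq_of_le_of_finrank_eq ?_ ?_
  -- Since `a²` is central, `[a, [a, x]] = 2(a²x - axa) = 0`, so the image lies in the kernel; both
  -- have dimension two.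
  · rintro _ ⟨x, rfl⟩
    rw [mem_ker_innerDerivation, innerDerivation_apply, mul_sub, sub_mul, ← mul_assoc, hn,
      mul_assoc x, hn, smul_mul_assoc, mul_smul_comm, one_mul, mul_one, ← mul_assoc,
      sub_eq_sub_iff_add_eq_add, h2, h2]
  · have h1 := LinearMap.finrank_range_add_finrank_ker (innerDerivation F a)
    rw [ker_innerDerivation hQ h4 ha, finrank_span_self_one ha] at h1 ⊢
    omega

/-- A Lie ideal of a four-dimensional prime algebra of characteristic two that contains a noncentral
element of nonzero trace is the whole algebra. -/
theorem mem_of_mul_self_eq (hQ : ∀ p q : Q, (∀ x, p * x * q = 0) → p = 0 ∨ q = 0)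
    (h4 : Module.finrank F Q = 4) (h2 : ∀ x : Q, x + x = 0) {V : Submodule F Q}
    (hV : ∀ v ∈ V, ∀ x, v * x - x * v ∈ V) {a z : Q} (haV : a ∈ V) (ha : a * z ≠ z * a)
    {s n : F} (hs : s ≠ 0) (hn : a * a = s • a + n • (1 : Q)) (x : Q) : x ∈ V := by
  -- In characteristic two, `D = [a, ·]` satisfies `D² = [a², ·] = sD`, so `s⁻¹D` is a projection.
  -- An eigenvector `b` of `D` with eigenvalue `s` turns out to have central square, which puts `1`
  -- into `V`.
  have had : ∀ x, a * (a * x - x * a) - (a * x - x * a) * a = s • (a * x - x * a) := by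
    intro x
    calc a * (a * x - x * a) - (a * x - x * a) * a
        = (a * a) * x - x * (a * a) - (a * x * a + a * x * a) + (x * (a * a) + x * (a * a)) := by
          noncomm_ring
      _ = s • (a * x - x * a) := by
          rw [h2, h2, hn, add_mul, mul_add, smul_mul_assoc, smul_mul_assoc, mul_smul_comm,
            mul_smul_comm, one_mul, mul_one, smul_sub]
          abel
  obtain ⟨b, hb⟩ : ∃ b, b = a * z - z * a := ⟨_, rfl⟩
  have hb0 : b ≠ 0 := hb ▸ sub_ne_zero.2 ha
  have hbV : b ∈ V := hb ▸ hV a haV z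
  have hab : a * b - b * a = s • b := by rw [hb, had]
  have hba : b * a ≠ a * b := fun h =>
    (smul_ne_zero hs hb0) (by rw [← hab, h, sub_self])
  have hbb : b * b ∈ F ∙ a ⊔ F ∙ (1 : Q) := by
    rw [← ker_innerDerivation hQ h4 ha, mem_ker_innerDerivation, ← sub_eq_zero]
    calc a * (b * b) - b * b * a = (a * b - b * a) * b + b * (a * b - b * a) := by noncomm_ring
      _ = 0 := by rw [hab, smul_mul_assoc, mul_smul_comm, h2]
  obtain ⟨p, q, hpq⟩ := mem_span_self_one.1 hbb
  -- `b² = pa + q` commutes with `b`, while `a` does not.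
  have hp : p = 0 := by
    have h : p • (a * b - b * a) = 0 := by
      calc p • (a * b - b * a) = (p • a + q • (1 : Q)) * b - b * (p • a + q • (1 : Q)) := by
            simp only [mul_add, add_mul, mul_smul_comm, smul_mul_assoc, mul_one, one_mul, smul_sub]
            abel
        _ = 0 := by rw [hpq, mul_assoc, sub_self]
    exact (smul_eq_zero.1 h).resolve_right (sub_ne_zero.2 hba.symm)
  rw [hp, zero_smul, zero_add] at hpq
  have h1V : (1 : Q) ∈ V := by
    have : (1 : Q) ∈ LinearMap.range (innerDerivation F b) := by
      rw [range_innerDerivation hQ h4 h2 hba hpq.symm]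
      exact le_sup_right (a := F ∙ b) (Submodule.mem_span_singleton_self _)
    obtain ⟨y, hy⟩ := this
    exact hy ▸ hV b hbV y
  -- The complementary projection sends `x` into `ker D = Fa + F ⊆ V`.
  have hker : x - s⁻¹ • (a * x - x * a) ∈ V := by
    have : x - s⁻¹ • (a * x - x * a) ∈ F ∙ a ⊔ F ∙ (1 : Q) := by
      rw [← ker_innerDerivation hQ h4 ha, LinearMap.mem_ker, map_sub, map_smul,
        innerDerivation_apply, innerDerivation_apply, had, inv_smul_smul₀ hs, sub_self]
    obtain ⟨p, q, h⟩ := mem_span_self_one.1 this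
    exact h ▸ V.add_mem (V.smul_mem _ haV) (V.smul_mem _ h1V)
  exact sub_add_cancel x (s⁻¹ • (a * x - x * a)) ▸ V.add_mem hker (V.smul_mem _ (hV a haV x))

/-- In a four-dimensional prime algebra of characteristic two, a Lie ideal that contains independent
noncentral elements with central squares contains all commutators. -/
theorem commutator_mem_of_independent (hQ : ∀ p q : Q, (∀ x, p * x * q = 0) → p = 0 ∨ q = 0)
    (h4 : Module.finrank F Q = 4) (h2 : ∀ x : Q, x + x = 0) {V : Submodule F Q}
    (hV : ∀ v ∈ V, ∀ x, v * x - x * v ∈ V) {a b z w : Q} (haV : a ∈ V) (hbV : b ∈ V)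
    (ha : a * z ≠ z * a) (hb : b * w ≠ w * b) {n m : F} (hn : a * a = n • (1 : Q))
    (hm : b * b = m • (1 : Q)) (hab : b ∉ F ∙ a ⊔ F ∙ (1 : Q)) (x y : Q) :
    x * y - y * x ∈ V := by
  have hra := range_innerDerivation hQ h4 h2 ha hn
  -- `[a, b]` lies in `(Fa + F) ∩ (Fb + F)`, which is `F` because `b ∉ Fa + F`.
  obtain ⟨k, hk⟩ : ∃ k : F, k • (1 : Q) = a * b - b * a := by
    have h1 : a * b - b * a ∈ F ∙ a ⊔ F ∙ (1 : Q) :=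
      hra ▸ LinearMap.mem_range_self (innerDerivation F a) b
    have h2 : a * b - b * a ∈ F ∙ b ⊔ F ∙ (1 : Q) := by
      rw [← range_innerDerivation hQ h4 h2 hb hm, ← neg_mem_iff, neg_sub]
      exact LinearMap.mem_range_self (innerDerivation F b) a
    obtain ⟨p, q, hpq⟩ := mem_span_self_one.1 h2
    by_cases hp : p = 0
    · exact ⟨q, by rw [← hpq, hp, zero_smul, zero_add]⟩
    · refine absurd ?_ hab
      have : p • b ∈ F ∙ a ⊔ F ∙ (1 : Q) := by
        rw [eq_sub_of_add_eq hpq]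
        exact Submodule.sub_mem _ h1 (le_sup_right (a := F ∙ a)
          (Submodule.smul_mem _ _ (Submodule.mem_span_singleton_self _)))
      exact (Submodule.smul_mem_iff _ hp).1 this
  have hk0 : k ≠ 0 := by
    rintro rfl
    refine hab ?_
    rw [← ker_innerDerivation hQ h4 ha, mem_ker_innerDerivation, ← sub_eq_zero, ← hk, zero_smul]
  have h1V : (1 : Q) ∈ V := (Submodule.smul_mem_iff _ hk0).1 (hk ▸ hV a haV b)
  -- `[a, ·]` sends `b` to `k` and `ab` to `ka`, which span its image. Subtracting suitable
  -- multiples of `b` and `ab` from `x` therefore leaves an element of the kernel `Fa + F ⊆ V`.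
  have hdec : ∀ x, ∃ v ∈ V, ∃ t : F, x = v + t • (a * b) := by
    intro x
    have hx : a * x - x * a ∈ F ∙ a ⊔ F ∙ (1 : Q) :=
      hra ▸ LinearMap.mem_range_self (innerDerivation F a) x
    obtain ⟨u, w, huw⟩ := mem_span_self_one.1 hx
    have hker : x - (k⁻¹ * u) • (a * b) - (k⁻¹ * w) • b ∈ F ∙ a ⊔ F ∙ (1 : Q) := by
      rw [← ker_innerDerivation hQ h4 ha, LinearMap.mem_ker, map_sub, map_sub, map_smul, map_smul,
        innerDerivation_apply, innerDerivation_apply, innerDerivation_apply, ← huw,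
        show a * (a * b) - a * b * a = k • a by rw [mul_assoc, ← mul_sub, ← hk, mul_smul_comm,
          mul_one], ← hk, smul_smul, smul_smul, mul_right_comm, mul_right_comm _ w,
        inv_mul_cancel₀ hk0, one_mul, one_mul]
      abel
    obtain ⟨p, q, h⟩ := mem_span_self_one.1 hker
    refine ⟨p • a + q • (1 : Q) + (k⁻¹ * w) • b, V.add_mem (V.add_mem (V.smul_mem _ haV)
      (V.smul_mem _ h1V)) (V.smul_mem _ hbV), k⁻¹ * u, ?_⟩
    rw [h]
    abel
  obtain ⟨v, hv, t, rfl⟩ := hdec x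
  obtain ⟨v', hv', t', rfl⟩ := hdec y
  -- As `[ab, ab] = 0`, each remaining bracket has an entry in `V`.
  rw [show (v + t • (a * b)) * (v' + t' • (a * b)) - (v' + t' • (a * b)) * (v + t • (a * b)) =
      (v * (v' + t' • (a * b)) - (v' + t' • (a * b)) * v) - t • (v' * (a * b) - a * b * v') by
    simp only [mul_add, add_mul, mul_smul_comm, smul_mul_assoc, smul_sub, smul_add,
      smul_comm t' t]
    abel]
  exact V.sub_mem (hV v hv _) (V.smul_mem _ (hV v' hv' _))

/-- The classification of the Lie ideals of a four-dimensional prime algebra of characteristic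
two. -/
theorem lieIdeal_trichotomy (hQ : ∀ p q : Q, (∀ x, p * x * q = 0) → p = 0 ∨ q = 0)
    (h4 : Module.finrank F Q = 4) (h2 : ∀ x : Q, x + x = 0) {X : Set Q}
    (hV : ∀ v ∈ Submodule.span F X, ∀ x, v * x - x * v ∈ Submodule.span F X) :
    (∀ a ∈ X, ∀ x, a * x = x * a) ∨
    (∃ a ∈ X, (∃ x, a * x ≠ x * a) ∧
      Submodule.span F X = LinearMap.range (innerDerivation F a) ∧
      LinearMap.range (innerDerivation F a) = F ∙ a ⊔ F ∙ (1 : Q)) ∨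
    ∀ x y, x * y - y * x ∈ Submodule.span F X := by
  by_cases hX : ∀ a ∈ X, ∀ x, a * x = x * a
  · exact Or.inl hX
  right
  push Not at hX
  obtain ⟨a, haX, z, ha⟩ := hX
  -- `a²` lies in the centralizer `Fa + F` of `a`.
  have hquad : ∀ a z : Q, a * z ≠ z * a → ∃ s n : F, s • a + n • (1 : Q) = a * a :=
    fun a z ha => mem_span_self_one.1 (by
      rw [← ker_innerDerivation hQ h4 ha, mem_ker_innerDerivation, mul_assoc])
  -- Only generators are tested, not their span, so that the witness `a` of the second case comes
  -- from `L` itself and not merely from `LC`.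
  by_cases htr : ∀ a ∈ X, ∀ z, a * z ≠ z * a → ∃ n : F, a * a = n • (1 : Q)
  · obtain ⟨n, hn⟩ := htr a haX z ha
    by_cases hle : X ⊆ (F ∙ a ⊔ F ∙ (1 : Q) : Submodule F Q)
    · have hr := range_innerDerivation hQ h4 h2 ha hn
      refine Or.inl ⟨a, haX, ⟨z, ha⟩, le_antisymm (hr ▸ Submodule.span_le.2 hle) ?_, hr⟩
      rintro _ ⟨x, rfl⟩
      exact hV a (Submodule.subset_span haX) x
    · obtain ⟨b, hbX, hb⟩ := Set.not_subset.1 hle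
      have : ∃ w, b * w ≠ w * b := by
        by_contra! hw
        exact hb (ker_innerDerivation hQ h4 ha ▸ mem_ker_innerDerivation.2 (hw a).symm)
      obtain ⟨w, hw⟩ := this
      obtain ⟨m, hm⟩ := htr b hbX w hw
      exact Or.inr (commutator_mem_of_independent hQ h4 h2 hV (Submodule.subset_span haX)
        (Submodule.subset_span hbX) ha hw hn hm hb)
  · push Not at htr
    obtain ⟨a, haX, z, ha, hn⟩ := htr
    obtain ⟨s, n, hsn⟩ := hquad a z ha
    have hs : s ≠ 0 := by
      rintro rfl
      exact hn n (by rw [← hsn, zero_smul, zero_add])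
    exact Or.inr fun x y =>
      mem_of_mul_self_eq hQ h4 h2 hV (Submodule.subset_span haX) ha hs hsn.symm _

end quaternion

/-! ### The central closure `RC` and transfer between `R` and `Q_s(R)` -/

namespace Martindale

variable {R : Type*} [NonUnitalRing R] [IsPrimeRing R]

/-- The field structure of the extended centroid. -/
noncomputable abbrev extendedCentroidField : Field (extendedCentroid R) :=
  isField_extendedCentroid.toField

section field

attribute [local instance] extendedCentroidField

theorem mul_mem_extendScalars {A B D : Set R} (h : ∀ a ∈ A, ∀ b ∈ B, a * b ∈ D) {x y : Qs R}
    (hx : x ∈ extendScalars A) (hy : y ∈ extendScalars B) : x * y ∈ extendScalars D := by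
  have : x * y ∈ extendScalars A * extendScalars B := Submodule.mul_mem_mul hx hy
  rw [extendScalars, extendScalars, Submodule.span_mul_span] at this
  refine Submodule.span_mono ?_ this
  rintro _ ⟨_, ⟨a, ha, rfl⟩, _, ⟨b, hb, rfl⟩, rfl⟩
  exact ⟨a * b, h a ha b hb, map_mul _ _ _⟩

theorem toQs_mem_extendScalars {A : Set R} {a : R} (ha : a ∈ A) : toQs R a ∈ extendScalars A :=
  Submodule.subset_span ⟨a, ha, rfl⟩

/-- `IC` is a nonzero ideal of `RC`, and `Q_s(R)` is prime relative to `RC` because it is so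
relative to `R`. -/
theorem one_mem_extendScalars_ideal [Module.Finite (extendedCentroid R) (centralClosure R)]
    {I : TwoSidedIdeal R} (hI : I ≠ ⊥) : (1 : Qs R) ∈ extendScalars (I : Set R) := by
  refine one_mem_of_prime (centralClosure R) _
    (fun x hx y hy => mul_mem_extendScalars (fun _ _ _ _ => Set.mem_univ _) hx hy)
    (fun p q h => Qs.eq_zero_or_eq_zero fun r => h _ (toQs_mem_extendScalars (Set.mem_univ r)))
    (Submodule.span_mono (Set.image_mono (Set.subset_univ _)))
    (fun x hx y hy => mul_mem_extendScalars (fun _ _ _ hb => I.mul_mem_left _ _ hb) hx hy)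
    (fun x hx y hy => mul_mem_extendScalars (fun _ ha _ _ => I.mul_mem_right _ _ ha) hx hy) ?_
  obtain ⟨x, hx, hx0⟩ := exists_mem_ne_zero hI
  refine (Submodule.ne_bot_iff _).2 ⟨toQs R x, toQs_mem_extendScalars hx, fun h => hx0 ?_⟩
  exact toQs_injective R (h.trans (_root_.map_zero _).symm)

/-- If `RC` is finite-dimensional over `C`, then it is all of `Q_s(R)`. -/
theorem centralClosure_eq_top [Module.Finite (extendedCentroid R) (centralClosure R)] :
    centralClosure R = ⊤ := by
  refine (Submodule.eq_top_iff').2 fun q => ?_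
  obtain ⟨I, hI, hq⟩ := q.exists_ideal
  have : ∀ x ∈ extendScalars (I : Set R), q * x ∈ centralClosure R := by
    intro x hx
    refine Submodule.span_induction ?_ ?_ ?_ ?_ hx
    · rintro _ ⟨x, hx, rfl⟩
      obtain ⟨y, hy⟩ := (hq x hx).1
      exact hy ▸ toQs_mem_extendScalars (Set.mem_univ y)
    · rw [mul_zero]
      exact Submodule.zero_mem _
    · intro x y _ _ hx hy
      rw [mul_add]
      exact Submodule.add_mem _ hx hy
    · intro c x _ hx
      rw [mul_smul_comm]
      exact Submodule.smul_mem _ c hx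
  exact mul_one q ▸ this 1 (one_mem_extendScalars_ideal hI)

end field

/-- The bracket is `C`-bilinear, so the Lie ideal property passes from generators to spans. -/
theorem commutator_mem_extendScalars {L : AddSubgroup R} (hL : IsLieIdeal L) {v x : Qs R}
    (hv : v ∈ extendScalars (L : Set R)) (hx : x ∈ centralClosure R) :
    v * x - x * v ∈ extendScalars (L : Set R) := by
  induction hv using Submodule.span_induction with
  | zero => simp
  | add v w _ _ hv hw =>
    rw [add_mul, mul_add, add_sub_add_comm]
    exact Submodule.add_mem _ hv hw
  | smul c v _ hv =>
    rw [smul_mul_assoc, mul_smul_comm, ← smul_sub]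
    exact Submodule.smul_mem _ c hv
  | mem v hv =>
    obtain ⟨a, ha, rfl⟩ := hv
    induction hx using Submodule.span_induction with
    | zero => simp
    | add x y _ _ hx hy =>
      rw [add_mul, mul_add, add_sub_add_comm]
      exact Submodule.add_mem _ hx hy
    | smul c x _ hx =>
      rw [smul_mul_assoc, mul_smul_comm, ← smul_sub]
      exact Submodule.smul_mem _ c hx
    | mem x hx =>
      obtain ⟨r, -, rfl⟩ := hx
      rw [← map_mul, ← map_mul, ← map_sub]
      exact toQs_mem_extendScalars
        (hL (AddSubgroup.subset_closure ⟨a, ha, r, Set.mem_univ r, rfl⟩))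

/-- If `R` has exponent two, then so has `Q_s(R)`. -/
theorem Qs.add_self_eq_zero (h : AddMonoid.exponent R = 2) (x : Qs R) : x + x = 0 := by
  refine Qs.eq_zero_of_ideal_mul top_ne_bot fun r _ => ?_
  have hr : r + r = 0 := by
    rw [← two_nsmul, ← h]
    exact AddMonoid.exponent_nsmul_eq_zero r
  rw [mul_add, ← add_mul, ← _root_.map_add, hr, _root_.map_zero, zero_mul]

theorem toQs_commute_of_mem_center {a : R} (ha : a ∈ Set.center R) (q : Qs R) :
    toQs R a * q = q * toQs R a := by
  refine (Subring.mem_center_iff.1 (mem_extendedCentroid_of_commute fun r => ?_) q).symm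
  rw [← map_mul, ← map_mul, (Semigroup.mem_center_iff.1 ha r).symm]

theorem mem_center_of_toQs_commute {a : R} (h : ∀ q : Qs R, toQs R a * q = q * toQs R a) :
    a ∈ Set.center R :=
  Semigroup.mem_center_iff.2 fun r => toQs_injective R (by rw [map_mul, map_mul, h])

attribute [local instance] extendedCentroidField in
theorem commutatorSubgroup_singleton_top (a : Qs R) :
    commutatorSubgroup {a} ((⊤ : Submodule (extendedCentroid R) (Qs R)) : Set (Qs R)) =
      (LinearMap.range (innerDerivation (extendedCentroid R) a)).toAddSubgroup := by
  refine le_antisymm ((AddSubgroup.closure_le _).2 ?_) ?_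
  · rintro _ ⟨_, rfl, x, -, rfl⟩
    exact ⟨x, rfl⟩
  · rintro _ ⟨x, rfl⟩
    exact AddSubgroup.subset_closure ⟨a, rfl, x, Set.mem_univ x, rfl⟩

end Martindale

theorem mainTheorem8 {R : Type*} [NonUnitalRing R] [IsPrimeRing R]
    (hR : Martindale.IsExceptional R) (L : AddSubgroup R) (hL : IsLieIdeal L) :
    (L : Set R) ⊆ Set.center R ∨
    (∃ a ∈ L, a ∉ Set.center R ∧
      (Martindale.extendScalars (L : Set R)).toAddSubgroup =
        commutatorSubgroup {Martindale.toQs R a} (Martindale.centralClosure R : Set _) ∧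
      commutatorSubgroup {Martindale.toQs R a} (Martindale.centralClosure R : Set _) =
        (Submodule.span (Martindale.extendedCentroid R) {Martindale.toQs R a} ⊔
          Submodule.span (Martindale.extendedCentroid R) {1}).toAddSubgroup) ∨
    commutatorSubgroup (Martindale.centralClosure R : Set (Martindale.Qs R))
        (Martindale.centralClosure R : Set (Martindale.Qs R)) ≤
      (Martindale.extendScalars (L : Set R)).toAddSubgroup := by
  let := Martindale.extendedCentroidField (R := R)
  have h4 := Module.finrank_eq_of_rank_eq hR.2
  -- `finrank` is `0` by default in infinite dimension, so the value 4 certifies finiteness.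
  have : Module.Finite (Martindale.extendedCentroid R) (Martindale.centralClosure R) :=
    Module.finite_of_finrank_pos (by rw [h4]; norm_num)
  have htop := Martindale.centralClosure_eq_top (R := R)
  have hV : ∀ v ∈ Martindale.extendScalars (L : Set R), ∀ x,
      v * x - x * v ∈ Martindale.extendScalars (L : Set R) := fun v hv x =>
    Martindale.commutator_mem_extendScalars hL hv (htop ▸ Submodule.mem_top)
  rw [htop] at h4 ⊢
  rw [finrank_top] at h4
  have : FiniteDimensional (Martindale.extendedCentroid R) (Martindale.Qs R) :=
    Module.finite_of_finrank_pos (by rw [h4]; norm_num)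
  rcases lieIdeal_trichotomy (fun p q h => Martindale.Qs.eq_zero_or_eq_zero fun r => h _) h4
    (Martindale.Qs.add_self_eq_zero hR.1) hV with h | ⟨_, ⟨a, ha, rfl⟩, ⟨x, hx⟩, h1, h2⟩ | h
  · exact Or.inl fun a ha => Martindale.mem_center_of_toQs_commute (h _ ⟨a, ha, rfl⟩)
  · refine Or.inr (Or.inl
      ⟨a, ha, fun hc => hx (Martindale.toQs_commute_of_mem_center hc x), ?_, ?_⟩)
    · rw [Martindale.commutatorSubgroup_singleton_top]
      exact congrArg Submodule.toAddSubgroup h1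
    · rw [Martindale.commutatorSubgroup_singleton_top]
      exact congrArg Submodule.toAddSubgroup h2
  · refine Or.inr (Or.inr ((AddSubgroup.closure_le _).2 ?_))
    rintro _ ⟨x, -, y, -, rfl⟩
    exact h x y
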